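/- Let $A$ be a (real or complex) Banach algebra, not assumed to have a unit. Write $A^*$ and $A^{**}$ for its first and second duals. For $a,b\in A$, $f\in A^*$ and $F,G\in A^{**}$ define $f.a,\ F.f,\ a\circ f,\ f\circ F\in A^*$ and the first and second Arens products $F.G,\ F\circ G\in A^{**}$ by $$\langle f.a,b\rangle=f(ab),\quad \langle F.f,a\rangle=\langle F,f.a\rangle,\quad \langle F.G,f\rangle=\langle F,G.f\rangle,$$ $$\langle a\circ f,b\rangle=f(ba),\quad \langle f\circ F,a\rangle=\langle F,a\circ f\rangle,\quad \langle F\circ G,f\rangle=\langle G,f\circ F\rangle.$$ Suppose that $A$ is Arens regular, that is, $F.G=F\circ G$ for all $F,G\in A^{**}$, and that $A$ has a bounded approximate identity, that is, a bounded net $(e_\alpha)$ in $A$ with $ae_\alpha\to a$ and $e_\alpha a\to a$ in norm for every $a\in A$. Then: (i) $A^*$ factors on both sides: $\{f.a: f\in A^*,\ a\in A\}=A^*$ and $\{a\circ f: a\in A,\ f\in A^*\}=A^*$. (ii) $A^{**}$ with the first Arens product is unital, that is, there is $E\in A^{**}$ with $E.F=F.E=F$ for all $F\in A^{**}$. If moreover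 $A$ is weakly sequentially complete, that is, every weakly Cauchy sequence in $A$ converges weakly to an element of $A$, then $A$ is unital, that is, there is $e\in A$ with $ex=xe=x$ for all $x\in A$. -/

import Mathlib

noncomputable section

namespace ArensProducts

open Filter Topology

/-- The transpose of a bounded bilinear map `B : X × Y → Z`: the bounded bilinear map
`Z* × X → Y*` given by `⟨Bᵗ(f, x), y⟩ = ⟨f, B(x, y)⟩`. -/
def bilinTranspose {𝕜 X Y Z : Type*} [RCLike 𝕜]
    [NormedAddCommGroup X] [NormedSpace 𝕜 X] [NormedAddCommGroup Y] [NormedSpace 𝕜 Y]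
    [NormedAddCommGroup Z] [NormedSpace 𝕜 Z] (B : X →L[𝕜] Y →L[𝕜] Z) :
    StrongDual 𝕜 Z →L[𝕜] X →L[𝕜] StrongDual 𝕜 Y :=
  ((ContinuousLinearMap.compL 𝕜 X (Y →L[𝕜] Z) (StrongDual 𝕜 Y)).flip B).comp
    (ContinuousLinearMap.compL 𝕜 Y Z 𝕜)

theorem bilinTranspose_apply {𝕜 X Y Z : Type*} [RCLike 𝕜]
    [NormedAddCommGroup X] [NormedSpace 𝕜 X] [NormedAddCommGroup Y] [NormedSpace 𝕜 Y]
    [NormedAddCommGroup Z] [NormedSpace 𝕜 Z] (B : X →L[𝕜] Y →L[𝕜] Z)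
    (f : StrongDual 𝕜 Z) (x : X) (y : Y) : bilinTranspose B f x y = f (B x y) := rfl

section Algebra

variable (𝕜 : Type*) [RCLike 𝕜] {A : Type*} [NonUnitalNormedRing A] [NormedSpace 𝕜 A]
  [IsScalarTower 𝕜 A A] [SMulCommClass 𝕜 A A]

/-- The functional `f.a`, where `⟨f.a, b⟩ = ⟨f, ab⟩`. -/
def dualMul (f : StrongDual 𝕜 A) (a : A) : StrongDual 𝕜 A :=
  bilinTranspose (ContinuousLinearMap.mul 𝕜 A) f a

/-- The functional `F.f`, where `⟨F.f, a⟩ = ⟨F, f.a⟩`. -/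
def bidualDualMul (F : StrongDual 𝕜 (StrongDual 𝕜 A)) (f : StrongDual 𝕜 A) : StrongDual 𝕜 A :=
  bilinTranspose (bilinTranspose (ContinuousLinearMap.mul 𝕜 A)) F f

/-- The first Arens product `F.G`, where `⟨F.G, f⟩ = ⟨F, G.f⟩`. -/
def firstArens (F G : StrongDual 𝕜 (StrongDual 𝕜 A)) : StrongDual 𝕜 (StrongDual 𝕜 A) :=
  bilinTranspose (bilinTranspose (bilinTranspose (ContinuousLinearMap.mul 𝕜 A))) F G

/-- The functional `a ∘ f`, where `⟨a ∘ f, b⟩ = ⟨f, ba⟩`. -/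
def mulDual (a : A) (f : StrongDual 𝕜 A) : StrongDual 𝕜 A :=
  bilinTranspose (ContinuousLinearMap.mul 𝕜 A).flip f a

/-- The functional `f ∘ F`, where `⟨f ∘ F, a⟩ = ⟨F, a ∘ f⟩`. -/
def dualBidualMul (f : StrongDual 𝕜 A) (F : StrongDual 𝕜 (StrongDual 𝕜 A)) : StrongDual 𝕜 A :=
  bilinTranspose (bilinTranspose (ContinuousLinearMap.mul 𝕜 A).flip) F f

/-- The second Arens product `F ∘ G`, where `⟨F ∘ G, f⟩ = ⟨G, f ∘ F⟩`. -/
def secondArens (F G : StrongDual 𝕜 (StrongDual 𝕜 A)) : StrongDual 𝕜 (StrongDual 𝕜 A) :=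
  bilinTranspose (bilinTranspose (bilinTranspose (ContinuousLinearMap.mul 𝕜 A).flip)) G F

theorem dualMul_apply (f : StrongDual 𝕜 A) (a b : A) : dualMul 𝕜 f a b = f (a * b) := rfl

theorem bidualDualMul_apply (F : StrongDual 𝕜 (StrongDual 𝕜 A)) (f : StrongDual 𝕜 A) (a : A) :
    bidualDualMul 𝕜 F f a = F (dualMul 𝕜 f a) := rfl

theorem firstArens_apply (F G : StrongDual 𝕜 (StrongDual 𝕜 A)) (f : StrongDual 𝕜 A) :
    firstArens 𝕜 F G f = F (bidualDualMul 𝕜 G f) := rfl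

theorem mulDual_apply (a : A) (f : StrongDual 𝕜 A) (b : A) : mulDual 𝕜 a f b = f (b * a) := rfl

theorem dualBidualMul_apply (f : StrongDual 𝕜 A) (F : StrongDual 𝕜 (StrongDual 𝕜 A)) (a : A) :
    dualBidualMul 𝕜 f F a = F (mulDual 𝕜 a f) := rfl

theorem secondArens_apply (F G : StrongDual 𝕜 (StrongDual 𝕜 A)) (f : StrongDual 𝕜 A) :
    secondArens 𝕜 F G f = G (dualBidualMul 𝕜 f F) := rfl

variable (A)

/-- `A` is Arens regular: the two Arens products on `A**` coincide. -/
def IsArensRegular : Prop :=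
  ∀ F G : StrongDual 𝕜 (StrongDual 𝕜 A), firstArens 𝕜 F G = secondArens 𝕜 F G

/-- The set `A*A = {f.a : f ∈ A*, a ∈ A}` (products only, no linear span). -/
def dualMulSet : Set (StrongDual 𝕜 A) := {g | ∃ (f : StrongDual 𝕜 A) (a : A), g = dualMul 𝕜 f a}

/-- The set `AA* = {a ∘ f : a ∈ A, f ∈ A*}` (products only, no linear span). -/
def mulDualSet : Set (StrongDual 𝕜 A) := {g | ∃ (a : A) (f : StrongDual 𝕜 A), g = mulDual 𝕜 a f}

/-- `A*` factors on the left: `A*A = A*`. -/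
def DualFactorsLeft : Prop := dualMulSet 𝕜 A = Set.univ

/-- `A*` factors on the right: `AA* = A*`. -/
def DualFactorsRight : Prop := mulDualSet 𝕜 A = Set.univ

end Algebra

/-- A two-sided bounded approximate identity of `A`: a bounded net `e` in `A` with `a e_i → a` and
`e_i a → a` for every `a`. -/
structure IsBAI {A ι : Type*} [NonUnitalNormedRing A] [Preorder ι] (e : ι → A) : Prop where
  bounded : ∃ C : ℝ, ∀ i, ‖e i‖ ≤ C
  tendsto_mul_left : ∀ a : A, Tendsto (fun i => a * e i) atTop (𝓝 a)
  tendsto_mul_right : ∀ a : A, Tendsto (fun i => e i * a) atTop (𝓝 a)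

/-- The multiplication `m` on `X` has a two-sided unit. -/
def HasUnit {X : Type*} (m : X → X → X) : Prop := ∃ e : X, ∀ x : X, m e x = x ∧ m x e = x

/-- Every weakly Cauchy sequence of `X` has a weak limit in `X`. -/
def IsWeaklySeqComplete (𝕜 X : Type*) [RCLike 𝕜] [NormedAddCommGroup X] [NormedSpace 𝕜 X] : Prop :=
  ∀ x : ℕ → X, (∀ f : StrongDual 𝕜 X, CauchySeq (fun n => f (x n))) →
    ∃ l : X, ∀ f : StrongDual 𝕜 X, Tendsto (fun n => f (x n)) atTop (𝓝 (f l))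

end ArensProducts

end

/-!
A weak-star cluster point `E` of the approximate identity always satisfies `F.E = F` and
`E ∘ F = F`, so Arens regularity makes it a two-sided unit of the bidual
(`exists_firstArens_unit`).

If `F ∈ A**` annihilates all products `f.a` with `a ∈ A`, then `F.f = 0`, and so
`⟨F, f⟩ = ⟨E.F, f⟩ = ⟨E, F.f⟩ = 0`. By Hahn-Banach `f` lies in the closed span of `A*A`, hence
`f.e_α → f` in norm, and Cohen's factorization theorem (`exists_eq_apply_of_tendsto`) writes `f` as
a single product. The other side is the same, with `⟨F, f⟩ = ⟨F ∘ E, f⟩ = ⟨E, f ∘ F⟩`.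

For the unit of a weakly sequentially complete `A`, let `u_n` be a bounded sequence that is an
approximate identity for its own terms. Two weak-star cluster points `F`, `G` of it satisfy `F.G = F`
and `F ∘ G = G`; by regularity there is only one, the sequence is weakly Cauchy, and its weak limit
is an idempotent of `A` that is an identity for all `u_n`
(`exists_isIdempotentElem_weak_limit`). Choosing such a sequence from the approximate identity
gives, for each sequence in `A`, an idempotent that fixes it
(`exists_isIdempotentElem_fixing_seq`). If `A` had no unit, these idempotents would give a strictly
increasing bounded sequence, again with a weak limit in `A`. As it acts as an approximate identity
on its closed span, the limit is a norm limit, which forces the sequence to be eventually constant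
(`hasUnit_of_isWeaklySeqComplete`).
-/

namespace ArensProducts

open Filter Topology

/-! ### Approximate units acting on Banach spaces -/

section Action

variable {𝕜 X ι : Type*} [RCLike 𝕜] [NormedAddCommGroup X] [NormedSpace 𝕜 X] {l : Filter ι}

/-- A bounded family of operators converges strongly to the identity on a closed subspace.
Hence, by Hahn-Banach, convergence on `s` gives convergence at every point of the weakly closed
span of `s`. -/
theorem tendsto_apply_of_forall_dual {T : ι → X →L[𝕜] X} {C : ℝ} (hT : ∀ i, ‖T i‖ ≤ C)
    {s : Set X} (hs : ∀ y ∈ s, Tendsto (fun i => T i y) l (𝓝 y)) {x : X}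
    (hx : ∀ φ : StrongDual 𝕜 X, (∀ y ∈ s, φ y = 0) → φ x = 0) :
    Tendsto (fun i => T i x) l (𝓝 x) := by
  let K : Submodule 𝕜 X :=
    { carrier := {y | Tendsto (fun i => T i y) l (𝓝 y)}
      add_mem' := fun {a b} ha hb => by
        simpa only [Set.mem_ofPred_eq, map_add] using Tendsto.add ha hb
      zero_mem' := by
        simpa only [Set.mem_ofPred_eq, map_zero] using tendsto_const_nhds
      smul_mem' := fun c a ha => by
        simpa only [Set.mem_ofPred_eq, map_smul] using Tendsto.const_smul ha c }
  have hK : IsClosed (K : Set X) := by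
    refine isClosed_of_closure_subset fun y hy => ?_
    change Tendsto (fun i => T i y) l (𝓝 y)
    rw [Metric.tendsto_nhds]
    intro ε hε
    have hC : 0 < |C| + 2 := by positivity
    obtain ⟨z, hz, hyz⟩ := Metric.mem_closure_iff.1 hy (ε / (|C| + 2)) (by positivity)
    filter_upwards [Metric.tendsto_nhds.1 (show Tendsto (fun i => T i z) l (𝓝 z) from hz)
      (ε / (|C| + 2)) (by positivity)] with i hi
    have h1 : dist (T i y) (T i z) ≤ |C| * dist y z := by
      rw [dist_eq_norm, dist_eq_norm, ← map_sub]
      exact (T i).le_of_opNorm_le ((hT i).trans (le_abs_self C)) _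
    calc dist (T i y) y ≤ dist (T i y) (T i z) + dist (T i z) z + dist z y :=
          dist_triangle4 _ _ _ _
      _ < |C| * (ε / (|C| + 2)) + ε / (|C| + 2) + ε / (|C| + 2) := by
          rw [dist_comm z y]
          have : |C| * dist y z ≤ |C| * (ε / (|C| + 2)) := by gcongr
          linarith
      _ = ε := by field_simp; ring
  have : IsClosed (K : Set X) := hK
  have hq : K.mkQ x = 0 := by
    refine SeparatingDual.eq_zero_of_forall_dual_eq_zero (R := 𝕜) fun φ => ?_
    refine hx (φ.comp K.mkQL) fun y hy => ?_
    have : K.mkQ y = 0 := (Submodule.Quotient.mk_eq_zero K).2 (hs y hy)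
    change φ (K.mkQ y) = 0
    rw [this, map_zero]
  exact (Submodule.Quotient.mk_eq_zero K).1 hq

/-- With `c = (C + 2)⁻¹` and `‖E‖ ≤ C`, the operator `u = 1 - c (1 - E)` is invertible and
the norm of its inverse is bounded in terms of `C` only. -/
theorem isUnit_one_sub_smul [CompleteSpace X] {E : X →L[𝕜] X} {C : ℝ} (hC : 0 ≤ C)
    (hE : ‖E‖ ≤ C) :
    IsUnit (1 - (((C + 2)⁻¹ : ℝ) : 𝕜) • (1 - E)) ∧
      ‖Ring.inverse (1 - (((C + 2)⁻¹ : ℝ) : 𝕜) • (1 - E))‖ ≤ C + 2 := by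
  have h1 : ‖(((C + 2)⁻¹ : ℝ) : 𝕜) • (1 - E)‖ ≤ (C + 2)⁻¹ * (1 + C) := by
    rw [norm_smul, RCLike.norm_ofReal, abs_of_pos (by positivity)]
    gcongr
    exact (norm_sub_le _ _).trans (add_le_add ContinuousLinearMap.norm_id_le hE)
  have h2 : (C + 2)⁻¹ * (1 + C) = 1 - (C + 2)⁻¹ := by field_simp; ring
  have h3 : 0 < (C + 2)⁻¹ := by positivity
  have hu : IsUnit (1 - (((C + 2)⁻¹ : ℝ) : 𝕜) • (1 - E)) :=
    isUnit_one_sub_of_norm_lt_one (by linarith)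
  refine ⟨hu, ContinuousLinearMap.opNorm_le_bound _ (by positivity) fun y => ?_⟩
  set D := (((C + 2)⁻¹ : ℝ) : 𝕜) • (1 - E)
  set z := Ring.inverse (1 - D) y
  have hz : z - D z = y :=
    DFunLike.congr_fun (Ring.mul_inverse_cancel _ hu) y
  have h4 : ‖D z‖ ≤ (1 - (C + 2)⁻¹) * ‖z‖ := D.le_of_opNorm_le (h1.trans h2.le) z
  have h5 : ‖z‖ - ‖D z‖ ≤ ‖y‖ := hz ▸ norm_sub_norm_le z (D z)
  have h6 : (C + 2)⁻¹ * ‖z‖ ≤ ‖y‖ := by linarith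
  rwa [inv_mul_le_iff₀ (by positivity)] at h6

/-- If `‖E i‖ ≤ C` and `E i` acts on `S` asymptotically as the identity, so does the inverse of
`1 - c (1 - E i)`. -/
theorem tendsto_inverse_mul [CompleteSpace X] {E : ι → X →L[𝕜] X} {C : ℝ} (hC : 0 ≤ C)
    (hE : ∀ i, ‖E i‖ ≤ C) {S : X →L[𝕜] X} (hS : Tendsto (fun i => E i * S) l (𝓝 S)) :
    Tendsto (fun i => Ring.inverse (1 - (((C + 2)⁻¹ : ℝ) : 𝕜) • (1 - E i)) * S) l (𝓝 S) := by
  rw [tendsto_iff_norm_sub_tendsto_zero] at hS ⊢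
  refine squeeze_zero (fun _ => norm_nonneg _) (fun i => ?_)
    (by simpa using hS.const_mul ((C + 2) * (C + 2)⁻¹))
  obtain ⟨hu, hn⟩ := isUnit_one_sub_smul (𝕜 := 𝕜) hC (hE i)
  have h : Ring.inverse (1 - (((C + 2)⁻¹ : ℝ) : 𝕜) • (1 - E i)) * S - S =
      Ring.inverse (1 - (((C + 2)⁻¹ : ℝ) : 𝕜) • (1 - E i)) *
        (-((((C + 2)⁻¹ : ℝ) : 𝕜) • (E i * S - S))) := by
    have : -((((C + 2)⁻¹ : ℝ) : 𝕜) • (E i * S - S)) =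
        S - (1 - (((C + 2)⁻¹ : ℝ) : 𝕜) • (1 - E i)) * S := by
      simp only [sub_mul, one_mul, smul_mul_assoc, smul_sub]; abel
    rw [this, mul_sub, ← mul_assoc, Ring.inverse_mul_cancel _ hu, one_mul]
  rw [h]
  refine (norm_mul_le _ _).trans ?_
  rw [norm_neg, norm_smul, RCLike.norm_ofReal, abs_of_pos (by positivity : 0 < (C + 2)⁻¹),
    mul_assoc]
  gcongr

theorem tendsto_inverse_apply [CompleteSpace X] {E : ι → X →L[𝕜] X} {C : ℝ} (hC : 0 ≤ C)
    (hE : ∀ i, ‖E i‖ ≤ C) {x : X} (hx : Tendsto (fun i => E i x) l (𝓝 x)) :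
    Tendsto (fun i => Ring.inverse (1 - (((C + 2)⁻¹ : ℝ) : 𝕜) • (1 - E i)) x) l (𝓝 x) := by
  rw [tendsto_iff_norm_sub_tendsto_zero] at hx ⊢
  refine squeeze_zero (fun _ => norm_nonneg _) (fun i => ?_)
    (by simpa using hx.const_mul ((C + 2) * (C + 2)⁻¹))
  obtain ⟨hu, hn⟩ := isUnit_one_sub_smul (𝕜 := 𝕜) hC (hE i)
  have h : Ring.inverse (1 - (((C + 2)⁻¹ : ℝ) : 𝕜) • (1 - E i)) x - x =
      Ring.inverse (1 - (((C + 2)⁻¹ : ℝ) : 𝕜) • (1 - E i))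
        (-((((C + 2)⁻¹ : ℝ) : 𝕜) • (E i x - x))) := by
    have h1 : -((((C + 2)⁻¹ : ℝ) : 𝕜) • (E i x - x)) =
        x - (1 - (((C + 2)⁻¹ : ℝ) : 𝕜) • (1 - E i)) x := by
      simp [smul_sub]
    rw [h1, map_sub]
    congr 1
    exact (DFunLike.congr_fun (Ring.inverse_mul_cancel _ hu) x).symm
  rw [h]
  refine (ContinuousLinearMap.le_of_opNorm_le _ hn _).trans ?_
  rw [norm_neg, norm_smul, RCLike.norm_ofReal, abs_of_pos (by positivity : 0 < (C + 2)⁻¹),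
    mul_assoc]

end Action

/-! ### Cohen's factorization theorem -/

theorem tendsto_clm_apply {𝕜 X Y ι : Type*} [NontriviallyNormedField 𝕜] [NormedAddCommGroup X]
    [NormedSpace 𝕜 X] [NormedAddCommGroup Y] [NormedSpace 𝕜 Y] {l : Filter ι}
    {S : ι → X →L[𝕜] Y} {S₀ : X →L[𝕜] Y} {x : ι → X} {x₀ : X} (hS : Tendsto S l (𝓝 S₀))
    (hx : Tendsto x l (𝓝 x₀)) : Tendsto (fun i => S i (x i)) l (𝓝 (S₀ x₀)) :=
  (isBoundedBilinearMap_apply.continuous.tendsto (S₀, x₀)).comp (hS.prodMk_nhds hx)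

section Cohen

variable {𝕜 X A ι : Type*} [RCLike 𝕜] [NormedAddCommGroup X] [NormedSpace 𝕜 X] [CompleteSpace X]
  [NormedAddCommGroup A] [NormedSpace 𝕜 A] {l : Filter ι}

/-- The inductive step of Cohen's factorization. From an invertible `b = d + T p` it passes to
`b' = u b''`, where `u = 1 - c (1 - T (e i))` and `b'' = d + u⁻¹ (T p)`; along the approximate
identity `b''` tends to `b`, so `b'` is eventually invertible and `b'⁻¹ x = b''⁻¹ (u⁻¹ x)` tends
to `b⁻¹ x`. Moreover `b' = d (1 - c) + T (p + d c e i)` has the same shape as `b`. -/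
theorem exists_factorization_step [NeBot l] (T : A →L[𝕜] X →L[𝕜] X) {e : ι → A} {C : ℝ}
    (hC : 0 ≤ C) (hT : ∀ i, ‖T (e i)‖ ≤ C)
    (hTT : ∀ j, Tendsto (fun i => T (e i) * T (e j)) l (𝓝 (T (e j))))
    {x : X} (hx : Tendsto (fun i => T (e i) x) l (𝓝 x)) (d : 𝕜) {p : A}
    (hp : IsUnit (d • 1 + T p)) (hTp : Tendsto (fun i => T (e i) * T p) l (𝓝 (T p)))
    {ε : ℝ} (hε : 0 < ε) :
    ∃ i, IsUnit ((d * (1 - (((C + 2)⁻¹ : ℝ) : 𝕜))) • 1 +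
        T (p + (d * (((C + 2)⁻¹ : ℝ) : 𝕜)) • e i)) ∧
      Tendsto (fun k => T (e k) * T (p + (d * (((C + 2)⁻¹ : ℝ) : 𝕜)) • e i)) l
        (𝓝 (T (p + (d * (((C + 2)⁻¹ : ℝ) : 𝕜)) • e i))) ∧
      dist (Ring.inverse (d • 1 + T p) x)
        (Ring.inverse ((d * (1 - (((C + 2)⁻¹ : ℝ) : 𝕜))) • 1 +
          T (p + (d * (((C + 2)⁻¹ : ℝ) : 𝕜)) • e i)) x) ≤ ε := by
  set c : 𝕜 := (((C + 2)⁻¹ : ℝ) : 𝕜)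
  have hz : Tendsto (fun i => d • 1 + Ring.inverse (1 - c • (1 - T (e i))) * T p) l
      (𝓝 (d • 1 + T p)) := tendsto_const_nhds.add (tendsto_inverse_mul hC hT hTp)
  have hzinv := (NormedRing.inverse_continuousAt hp.unit).tendsto.comp hz
  have hlim := tendsto_clm_apply hzinv (tendsto_inverse_apply hC hT hx)
  have hunit := hz.eventually (Units.isOpen.mem_nhds hp)
  obtain ⟨i, hi, hi'⟩ := (hunit.and (Metric.tendsto_nhds.1 hlim ε hε)).exists
  have hu := (isUnit_one_sub_smul (𝕜 := 𝕜) hC (hT i)).1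
  have key : (d * (1 - c)) • 1 + T (p + (d * c) • e i) =
      (1 - c • (1 - T (e i))) *
        (d • 1 + Ring.inverse (1 - c • (1 - T (e i))) * T p) := by
    rw [mul_add, ← mul_assoc, Ring.mul_inverse_cancel _ hu, one_mul, mul_smul_comm, mul_one,
      map_add, map_smul]
    module
  refine ⟨i, ?_, ?_, ?_⟩
  · rw [key]
    exact hu.mul hi
  · simp only [map_add, map_smul, mul_add, mul_smul_comm]
    exact hTp.add ((hTT i).const_smul _)
  · rw [key, dist_comm]
    have : Ring.inverse ((1 - c • (1 - T (e i))) *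
        (d • 1 + Ring.inverse (1 - c • (1 - T (e i))) * T p)) =
        Ring.inverse (d • 1 + Ring.inverse (1 - c • (1 - T (e i))) * T p) *
          Ring.inverse (1 - c • (1 - T (e i))) := by
      obtain ⟨u, hu'⟩ := hu
      obtain ⟨v, hv'⟩ := hi
      simp only [c] at hu' hv' ⊢
      rw [← hv', ← hu', ← Units.val_mul, Ring.inverse_unit, Ring.inverse_unit, Ring.inverse_unit,
        mul_inv_rev, Units.val_mul]
    rw [this]
    exact hi'.le

/-- **Cohen's factorization theorem**, for a space `X` on which `A` acts through a bounded linear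
map `T`. No multiplication on `A` enters, only that the operators `T (e i)` approximate an
identity on each other and at `x`; so the theorem covers left and right actions alike. -/
theorem exists_eq_apply_of_tendsto [CompleteSpace A] [NeBot l] (T : A →L[𝕜] X →L[𝕜] X)
    {e : ι → A} {C : ℝ} (he : ∀ i, ‖e i‖ ≤ C)
    (hTT : ∀ j, Tendsto (fun i => T (e i) * T (e j)) l (𝓝 (T (e j))))
    {x : X} (hx : Tendsto (fun i => T (e i) x) l (𝓝 x)) : ∃ a y, x = T a y := by
  obtain ⟨i₀⟩ := l.nonempty_of_neBot
  have hC₀ : 0 ≤ C := (norm_nonneg _).trans (he i₀)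
  set K := ‖T‖ * C
  have hK : 0 ≤ K := by positivity
  have hT : ∀ i, ‖T (e i)‖ ≤ K := fun i => T.le_opNorm_of_le (he i)
  set r : ℝ := 1 - (K + 2)⁻¹
  have hr0 : 0 ≤ r := by
    have : (K + 2)⁻¹ ≤ 1 := inv_le_one_of_one_le₀ (by linarith)
    simp only [r]; linarith
  have hr1 : r < 1 := by
    have : 0 < (K + 2)⁻¹ := by positivity
    simp only [r]; linarith
  set c : 𝕜 := (((K + 2)⁻¹ : ℝ) : 𝕜)
  have hc : 1 - c = (r : 𝕜) := by simp [c, r]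
  -- Here `r = 1 - c`; after `n` steps the invertible operator is `r ^ n + T p`.
  let Q : ℕ → A → Prop := fun n p => IsUnit ((r : 𝕜) ^ n • 1 + T p) ∧
    Tendsto (fun i => T (e i) * T p) l (𝓝 (T p))
  have step : ∀ (n : ℕ) (p : {p : A // Q n p}), ∃ q : {q : A // Q (n + 1) q},
      dist p.1 q.1 ≤ C * r ^ n ∧
      dist (Ring.inverse ((r : 𝕜) ^ n • 1 + T p.1) x)
        (Ring.inverse ((r : 𝕜) ^ (n + 1) • 1 + T q.1) x) ≤ 1 * (1 / 2) ^ n := by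
    rintro n ⟨p, hp, hTp⟩
    obtain ⟨i, h1, h2, h3⟩ := exists_factorization_step T hK hT hTT hx ((r : 𝕜) ^ n) hp hTp
      (show (0 : ℝ) < 1 * (1 / 2) ^ n by positivity)
    change IsUnit (((r : 𝕜) ^ n * (1 - c)) • 1 + T (p + ((r : 𝕜) ^ n * c) • e i)) at h1
    change dist _ (Ring.inverse (((r : 𝕜) ^ n * (1 - c)) • 1 +
      T (p + ((r : 𝕜) ^ n * c) • e i)) x) ≤ _ at h3
    rw [hc, ← pow_succ] at h1 h3
    refine ⟨⟨_, h1, h2⟩, ?_, h3⟩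
    have hc1 : ‖c‖ ≤ 1 := by
      rw [RCLike.norm_ofReal, abs_of_pos (by positivity)]
      exact inv_le_one_of_one_le₀ (by linarith)
    rw [dist_self_add_right, norm_smul, norm_mul, norm_pow, RCLike.norm_ofReal, abs_of_nonneg hr0]
    calc r ^ n * ‖c‖ * ‖e i‖ ≤ r ^ n * 1 * C := by gcongr; exact he i
      _ = C * r ^ n := by ring
  choose next hnext using step
  let s : (n : ℕ) → {p : A // Q n p} := fun n =>
    Nat.rec ⟨0, by simp [Q]⟩ (fun n p => next n p) n
  obtain ⟨a, ha⟩ := cauchySeq_tendsto_of_complete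
    (cauchySeq_of_le_geometric (f := fun n => (s n).1) r C hr1 fun n => (hnext n (s n)).1)
  obtain ⟨y, hy⟩ := cauchySeq_tendsto_of_complete
    (cauchySeq_of_le_geometric (f := fun n => Ring.inverse ((r : 𝕜) ^ n • 1 + T (s n).1) x)
      (1 / 2) 1 (by norm_num) fun n => (hnext n (s n)).2)
  refine ⟨a, y, tendsto_nhds_unique (f := fun _ : ℕ => x) (l := atTop) tendsto_const_nhds ?_⟩
  -- The scalar part `r ^ n` tends to `0`, so `x = (r ^ n + T (s n)) (y n)` tends to `T a y`.
  have hpow : Tendsto (fun n : ℕ => (r : 𝕜) ^ n) atTop (𝓝 0) :=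
    tendsto_pow_atTop_nhds_zero_of_norm_lt_one (by
      rwa [RCLike.norm_ofReal, abs_of_nonneg hr0])
  have hsum := (hpow.smul_const (1 : X →L[𝕜] X)).add ((T.continuous.tendsto a).comp ha)
  have := tendsto_clm_apply hsum hy
  rw [zero_smul, zero_add] at this
  refine this.congr fun n => ?_
  exact DFunLike.congr_fun (Ring.mul_inverse_cancel _ (s n).2.1) x

/-- Cohen's theorem for an arbitrary point of the weakly closed span of all products `T a y`. -/
theorem exists_eq_apply_of_forall_dual [CompleteSpace A] [NeBot l] (T : A →L[𝕜] X →L[𝕜] X)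
    {e : ι → A} {C : ℝ} (he : ∀ i, ‖e i‖ ≤ C)
    (hTT : ∀ a, Tendsto (fun i => T (e i) * T a) l (𝓝 (T a)))
    {x : X} (hx : ∀ φ : StrongDual 𝕜 X, (∀ a y, φ (T a y) = 0) → φ x = 0) :
    ∃ a y, x = T a y := by
  refine exists_eq_apply_of_tendsto T he (fun j => hTT (e j)) ?_
  refine tendsto_apply_of_forall_dual (C := ‖T‖ * C) (s := {z | ∃ a y, z = T a y})
    (fun i => T.le_opNorm_of_le (he i)) ?_ fun φ hφ => hx φ fun a y => hφ _ ⟨a, y, rfl⟩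
  rintro _ ⟨a, y, rfl⟩
  have := tendsto_clm_apply (hTT a) (tendsto_const_nhds (x := y))
  exact this

end Cohen

/-! ### Weak-star limits of bounded nets in the bidual -/

/-- Banach-Alaoglu for the image of a bounded family in the bidual. -/
theorem exists_bidual_tendsto {𝕜 X ι : Type*} [RCLike 𝕜] [NormedAddCommGroup X] [NormedSpace 𝕜 X]
    {e : ι → X} {C : ℝ} (he : ∀ i, ‖e i‖ ≤ C) (U : Ultrafilter ι) :
    ∃ F : StrongDual 𝕜 (StrongDual 𝕜 X), ∀ f : StrongDual 𝕜 X,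
      Tendsto (fun i => f (e i)) U (𝓝 (F f)) := by
  let g : ι → WeakDual 𝕜 (StrongDual 𝕜 X) := fun i =>
    StrongDual.toWeakDual (NormedSpace.inclusionInDoubleDual 𝕜 X (e i))
  obtain ⟨F, -, hF⟩ := (WeakDual.isCompact_closedBall (𝕜 := 𝕜)
      (0 : StrongDual 𝕜 (StrongDual 𝕜 X)) C).ultrafilter_le_nhds' (U.map g) (by
    refine Ultrafilter.mem_map.2 (Filter.mem_of_superset Filter.univ_mem fun i _ => ?_)
    exact (dist_zero_right (NormedSpace.inclusionInDoubleDual 𝕜 X (e i))).trans_le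
      ((NormedSpace.double_dual_bound 𝕜 X (e i)).trans (he i)))
  refine ⟨WeakDual.toStrongDual F, fun f => ?_⟩
  have h1 : Tendsto g U (𝓝 F) := hF
  exact ((WeakDual.eval_continuous f).tendsto F).comp h1

section Algebra

variable {𝕜 : Type*} [RCLike 𝕜] {A : Type*} [NonUnitalNormedRing A] [NormedSpace 𝕜 A]
  [IsScalarTower 𝕜 A A] [SMulCommClass 𝕜 A A]

/-- A weak-star cluster point `E` of a bounded approximate identity satisfies `F.E = F` and
`E ∘ F = F`; Arens regularity turns the second identity into `E.F = F`. -/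
theorem exists_firstArens_unit (hreg : IsArensRegular 𝕜 A) {ι : Type*} [Preorder ι]
    [IsDirectedOrder ι] [Nonempty ι] {e : ι → A} (he : IsBAI e) :
    ∃ E : StrongDual 𝕜 (StrongDual 𝕜 A), ∀ F, firstArens 𝕜 E F = F ∧ firstArens 𝕜 F E = F := by
  obtain ⟨C, hC⟩ := he.bounded
  obtain ⟨E, hE⟩ := exists_bidual_tendsto (𝕜 := 𝕜) hC (Ultrafilter.of atTop)
  have hle : ((Ultrafilter.of atTop : Ultrafilter ι) : Filter ι) ≤ atTop := Ultrafilter.of_le _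
  refine ⟨E, fun F => ⟨?_, ?_⟩⟩
  · rw [hreg]
    ext f
    rw [secondArens_apply]
    congr 1
    ext a
    rw [dualBidualMul_apply]
    exact tendsto_nhds_unique (hE _)
      ((f.continuous.tendsto a).comp ((he.tendsto_mul_right a).mono_left hle))
  · ext f
    rw [firstArens_apply]
    congr 1
    ext a
    rw [bidualDualMul_apply]
    exact tendsto_nhds_unique (hE _)
      ((f.continuous.tendsto a).comp ((he.tendsto_mul_left a).mono_left hle))

/-! ### Factorization of the dual -/

theorem dualFactorsLeft_of_isArensRegular [CompleteSpace A] (hreg : IsArensRegular 𝕜 A)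
    {ι : Type*} [Preorder ι] [IsDirectedOrder ι] [Nonempty ι] {e : ι → A} (he : IsBAI e) :
    DualFactorsLeft 𝕜 A := by
  obtain ⟨E, hE⟩ := exists_firstArens_unit hreg he
  obtain ⟨C, hC⟩ := he.bounded
  let T : A →L[𝕜] StrongDual 𝕜 A →L[𝕜] StrongDual 𝕜 A :=
    (bilinTranspose (ContinuousLinearMap.mul 𝕜 A)).flip
  have hmul : ∀ a b, T a * T b = T (b * a) := fun a b => by
    ext f c
    change f (b * (a * c)) = f (b * a * c)
    rw [mul_assoc]
  have hTT : ∀ a, Tendsto (fun i => T (e i) * T a) atTop (𝓝 (T a)) := fun a => by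
    simp only [hmul]
    exact (T.continuous.tendsto a).comp (he.tendsto_mul_left a)
  refine Set.eq_univ_of_forall fun f => ?_
  obtain ⟨a, g, hg⟩ : ∃ a g, f = T a g := by
    refine exists_eq_apply_of_forall_dual T hC hTT fun F hF => ?_
    -- `F.f = 0` because `F` annihilates every `f.a`.
    rw [← (hE F).1, firstArens_apply]
    have : bidualDualMul 𝕜 F f = 0 := by
      ext a
      exact hF a f
    rw [this, map_zero]
  exact ⟨g, a, hg⟩

theorem dualFactorsRight_of_isArensRegular [CompleteSpace A] (hreg : IsArensRegular 𝕜 A)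
    {ι : Type*} [Preorder ι] [IsDirectedOrder ι] [Nonempty ι] {e : ι → A} (he : IsBAI e) :
    DualFactorsRight 𝕜 A := by
  obtain ⟨E, hE⟩ := exists_firstArens_unit hreg he
  obtain ⟨C, hC⟩ := he.bounded
  let T : A →L[𝕜] StrongDual 𝕜 A →L[𝕜] StrongDual 𝕜 A :=
    (bilinTranspose (ContinuousLinearMap.mul 𝕜 A).flip).flip
  have hmul : ∀ a b, T a * T b = T (a * b) := fun a b => by
    ext f c
    change f (c * a * b) = f (c * (a * b))
    rw [mul_assoc]
  have hTT : ∀ a, Tendsto (fun i => T (e i) * T a) atTop (𝓝 (T a)) := fun a => by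
    simp only [hmul]
    exact (T.continuous.tendsto a).comp (he.tendsto_mul_right a)
  refine Set.eq_univ_of_forall fun f => ?_
  obtain ⟨a, g, hg⟩ : ∃ a g, f = T a g := by
    refine exists_eq_apply_of_forall_dual T hC hTT fun F hF => ?_
    -- `f ∘ F = 0` because `F` annihilates every `a ∘ f`, and `F = F.E = F ∘ E`.
    rw [← (hE F).2, hreg, secondArens_apply]
    have : dualBidualMul 𝕜 f F = 0 := by
      ext a
      exact hF a f
    rw [this, map_zero]
  exact ⟨a, g, hg⟩

/-! ### Units in weakly sequentially complete algebras -/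

/-- In an Arens regular algebra a bounded sequence that is an approximate identity for its own
terms is weakly Cauchy: two weak-star cluster points `F`, `G` satisfy `F.G = F` and `F ∘ G = G`.
Its weak limit is then an exact identity for the terms. -/
theorem exists_isIdempotentElem_weak_limit (hreg : IsArensRegular 𝕜 A)
    (hwsc : IsWeaklySeqComplete 𝕜 A) {e : ℕ → A} {C : ℝ} (he : ∀ n, ‖e n‖ ≤ C)
    (hl : ∀ m, Tendsto (fun n => e n * e m) atTop (𝓝 (e m)))
    (hr : ∀ m, Tendsto (fun n => e m * e n) atTop (𝓝 (e m))) :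
    ∃ u : A, ‖u‖ ≤ C ∧ IsIdempotentElem u ∧
      (∀ f : StrongDual 𝕜 A, Tendsto (fun n => f (e n)) atTop (𝓝 (f u))) ∧
      (∀ a, Tendsto (fun n => e n * a) atTop (𝓝 a) → u * a = a) ∧
      (∀ a, Tendsto (fun n => a * e n) atTop (𝓝 a) → a * u = a) := by
  have hFG : ∀ (U V : Ultrafilter ℕ), (U : Filter ℕ) ≤ atTop → (V : Filter ℕ) ≤ atTop →
      ∀ F G : StrongDual 𝕜 (StrongDual 𝕜 A),
      (∀ f : StrongDual 𝕜 A, Tendsto (fun n => f (e n)) U (𝓝 (F f))) →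
      (∀ f : StrongDual 𝕜 A, Tendsto (fun n => f (e n)) V (𝓝 (G f))) → F = G := by
    intro U V hU hV F G hF hG
    have h1 : firstArens 𝕜 F G = F := by
      ext f
      refine tendsto_nhds_unique (hF (bidualDualMul 𝕜 G f)) ((hF f).congr fun n => ?_)
      exact (tendsto_nhds_unique (hG (dualMul 𝕜 f (e n)))
        ((f.continuous.tendsto _).comp ((hr n).mono_left hV))).symm
    have h2 : secondArens 𝕜 F G = G := by
      ext f
      refine tendsto_nhds_unique (hG (dualBidualMul 𝕜 f F)) ((hG f).congr fun n => ?_)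
      exact (tendsto_nhds_unique (hF (mulDual 𝕜 (e n) f))
        ((f.continuous.tendsto _).comp ((hl n).mono_left hU))).symm
    rw [← h1, hreg, h2]
  obtain ⟨F, hF⟩ := exists_bidual_tendsto (𝕜 := 𝕜) he (Ultrafilter.of atTop)
  have hconv : ∀ f : StrongDual 𝕜 A, Tendsto (fun n => f (e n)) atTop (𝓝 (F f)) := by
    intro f
    rw [tendsto_iff_ultrafilter]
    intro V hV
    obtain ⟨G, hG⟩ := exists_bidual_tendsto (𝕜 := 𝕜) he V
    rw [hFG _ V (Ultrafilter.of_le _) hV F G hF hG]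
    exact hG f
  obtain ⟨u, hu⟩ := hwsc e fun f => (hconv f).cauchySeq
  have hul : ∀ a, Tendsto (fun n => e n * a) atTop (𝓝 a) → u * a = a := fun a ha =>
    (SeparatingDual.eq_iff_forall_dual_eq (R := 𝕜)).2 fun f =>
      tendsto_nhds_unique (hu (mulDual 𝕜 a f)) ((f.continuous.tendsto a).comp ha)
  have hur : ∀ a, Tendsto (fun n => a * e n) atTop (𝓝 a) → a * u = a := fun a ha =>
    (SeparatingDual.eq_iff_forall_dual_eq (R := 𝕜)).2 fun f =>
      tendsto_nhds_unique (hu (dualMul 𝕜 f a)) ((f.continuous.tendsto a).comp ha)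
  refine ⟨u, ?_, ?_, hu, hul, hur⟩
  · refine NormedSpace.norm_le_dual_bound 𝕜 u ((norm_nonneg _).trans (he 0)) fun f => ?_
    refine le_of_tendsto (hu f).norm (Eventually.of_forall fun n => ?_)
    rw [mul_comm]
    exact f.le_opNorm_of_le (he n)
  · refine (SeparatingDual.eq_iff_forall_dual_eq (R := 𝕜)).2 fun f =>
      tendsto_nhds_unique (hu (dualMul 𝕜 f u)) ((hu f).congr fun n => ?_)
    rw [dualMul_apply, hul _ (hl n)]

/-- The local unit is the weak limit of a sequence chosen from the approximate identity so as to
approximate an identity on the given elements and on its own terms. -/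
theorem exists_isIdempotentElem_fixing_seq (hreg : IsArensRegular 𝕜 A)
    (hwsc : IsWeaklySeqComplete 𝕜 A) {ι : Type*} [Preorder ι] [IsDirectedOrder ι] [Nonempty ι]
    {e : ι → A} (he : IsBAI e) {C : ℝ} (hC : ∀ i, ‖e i‖ ≤ C) (x : ℕ → A) :
    ∃ u : A, ‖u‖ ≤ C ∧ IsIdempotentElem u ∧ ∀ k, u * x k = x k ∧ x k * u = x k := by
  have hev : ∀ (a : A) (n : ℕ), ∀ᶠ i in atTop,
      dist (e i * a) a < 1 / ((n : ℝ) + 1) ∧ dist (a * e i) a < 1 / ((n : ℝ) + 1) := fun a n =>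
    (Metric.tendsto_nhds.1 (he.tendsto_mul_right a) _ Nat.one_div_pos_of_nat).and
      (Metric.tendsto_nhds.1 (he.tendsto_mul_left a) _ Nat.one_div_pos_of_nat)
  obtain ⟨s, hsx, hss⟩ := exists_seq_of_forall_finset_exists (α := ℕ × ι)
    (fun p => ∀ k ≤ p.1, dist (e p.2 * x k) (x k) < 1 / ((p.1 : ℝ) + 1) ∧
      dist (x k * e p.2) (x k) < 1 / ((p.1 : ℝ) + 1))
    (fun p q => p.1 < q.1 ∧ dist (e q.2 * e p.2) (e p.2) < 1 / ((q.1 : ℝ) + 1) ∧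
      dist (e p.2 * e q.2) (e p.2) < 1 / ((q.1 : ℝ) + 1)) (by
    intro S _
    set n := S.sup Prod.fst + 1
    obtain ⟨i, hi, hi'⟩ := (((Finset.range (n + 1)).eventually_all.2 fun k _ => hev (x k) n).and
      (S.eventually_all.2 fun p _ => hev (e p.2) n)).exists
    exact ⟨(n, i), fun k hk => hi k (Finset.mem_range.2 (Nat.lt_succ_of_le hk)), fun p hp =>
      ⟨Nat.lt_succ_of_le (Finset.le_sup (f := Prod.fst) hp), hi' p hp⟩⟩)
  have hmono : StrictMono fun n => (s n).1 := fun m n hmn => (hss m n hmn).1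
  have hlim : Tendsto (fun n => 1 / (((s n).1 : ℝ) + 1)) atTop (𝓝 0) :=
    tendsto_one_div_add_atTop_nhds_zero_nat.comp hmono.tendsto_atTop
  have key : ∀ (a : A) (g : ℕ → A),
      (∀ᶠ n in atTop, dist (g n) a < 1 / (((s n).1 : ℝ) + 1)) → Tendsto g atTop (𝓝 a) :=
    fun a g hg => tendsto_iff_dist_tendsto_zero.2
      (squeeze_zero' (Eventually.of_forall fun _ => dist_nonneg) (hg.mono fun _ h => h.le) hlim)
  obtain ⟨u, hu, hidem, -, hul, hur⟩ := exists_isIdempotentElem_weak_limit hreg hwsc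
    (e := fun n => e (s n).2) (fun n => hC _)
    (fun m => key _ _ ((eventually_gt_atTop m).mono fun n hn => (hss m n hn).2.1))
    (fun m => key _ _ ((eventually_gt_atTop m).mono fun n hn => (hss m n hn).2.2))
  have hge : ∀ k, ∀ᶠ n in atTop, k ≤ (s n).1 := fun k =>
    hmono.tendsto_atTop.eventually_ge_atTop k
  exact ⟨u, hu, hidem, fun k =>
    ⟨hul _ (key _ _ ((hge k).mono fun n hn => (hsx n k hn).1)),
      hur _ (key _ _ ((hge k).mono fun n hn => (hsx n k hn).2))⟩⟩

/-- If `A` had no unit, the local units would produce a strictly increasing bounded sequence of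
idempotents. Its weak limit `v` is a norm limit, because `v` lies in the closed span of the
sequence; but the idempotent `v - u n` vanishes as soon as its norm is less than `1`. -/
theorem hasUnit_of_isWeaklySeqComplete (hreg : IsArensRegular 𝕜 A)
    (hwsc : IsWeaklySeqComplete 𝕜 A) {ι : Type*} [Preorder ι] [IsDirectedOrder ι] [Nonempty ι]
    {e : ι → A} (he : IsBAI e) : HasUnit fun a b : A => a * b := by
  obtain ⟨C, hC⟩ := he.bounded
  by_contra hno
  have hx : ∀ u : A, ∃ x, ¬(u * x = x ∧ x * u = x) := by
    simpa [HasUnit] using hno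
  choose x hx using hx
  obtain ⟨u, hu, hinc⟩ := exists_seq_of_forall_finset_exists
    (fun u : A => ‖u‖ ≤ C ∧ IsIdempotentElem u)
    (fun u v => v * u = u ∧ u * v = u ∧ u ≠ v) (by
    intro S _
    have hS : ((S : Set A) ∪ x '' S ∪ {0}).Countable :=
      ((S.countable_toSet.union (S.countable_toSet.image x)).union (Set.countable_singleton 0))
    obtain ⟨y, hy⟩ := hS.exists_eq_range ⟨0, Or.inr rfl⟩
    obtain ⟨v, hv, hidem, hvy⟩ := exists_isIdempotentElem_fixing_seq hreg hwsc he hC y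
    have hfix : ∀ z ∈ (S : Set A) ∪ x '' S ∪ {0}, v * z = z ∧ z * v = z := by
      rw [hy]
      rintro _ ⟨k, rfl⟩
      exact hvy k
    refine ⟨v, ⟨hv, hidem⟩, fun w hw => ?_⟩
    obtain ⟨h1, h2⟩ := hfix w (Or.inl (Or.inl hw))
    refine ⟨h1, h2, ?_⟩
    rintro rfl
    exact hx w (hfix _ (Or.inl (Or.inr ⟨w, hw, rfl⟩))))
  have hl : ∀ m, Tendsto (fun n => u n * u m) atTop (𝓝 (u m)) := fun m =>
    tendsto_const_nhds.congr' ((eventually_gt_atTop m).mono fun n hn => (hinc m n hn).1.symm)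
  have hr : ∀ m, Tendsto (fun n => u m * u n) atTop (𝓝 (u m)) := fun m =>
    tendsto_const_nhds.congr' ((eventually_gt_atTop m).mono fun n hn => (hinc m n hn).2.1.symm)
  obtain ⟨v, -, hv, hweak, hvl, hvr⟩ :=
    exists_isIdempotentElem_weak_limit hreg hwsc (fun n => (hu n).1) hl hr
  have hnorm : Tendsto (fun n => u n * v) atTop (𝓝 v) := by
    refine tendsto_apply_of_forall_dual (𝕜 := 𝕜)
      (T := fun n => ContinuousLinearMap.mul 𝕜 A (u n)) (C := C) (s := Set.range u)
      (fun n => (ContinuousLinearMap.opNorm_mul_apply_le 𝕜 A _).trans (hu n).1) ?_ fun φ hφ => ?_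
    · rintro _ ⟨m, rfl⟩
      exact hl m
    · exact tendsto_nhds_unique (hweak φ)
        (tendsto_const_nhds.congr fun n => (hφ _ ⟨n, rfl⟩).symm)
  obtain ⟨N, hN⟩ := (Metric.tendsto_atTop.1 hnorm 1 one_pos)
  have heq : ∀ n ≥ N, u n = v := by
    intro n hn
    have h1 : v * u n = u n := hvl _ (hl n)
    have h2 : u n * v = u n := hvr _ (hr n)
    have h3 : ‖u n - v‖ < 1 := by simpa [dist_eq_norm, h2] using hN n hn
    have h4 : (u n - v) * (u n - v) = -(u n - v) := by
      rw [sub_mul, mul_sub, mul_sub, (hu n).2.eq, hv.eq, h1, h2]; abel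
    have h5 : ‖u n - v‖ ≤ ‖u n - v‖ * ‖u n - v‖ := by
      simpa only [h4, norm_neg] using norm_mul_le (u n - v) (u n - v)
    have h6 : ‖u n - v‖ = 0 := by nlinarith [norm_nonneg (u n - v)]
    exact sub_eq_zero.1 (norm_eq_zero.1 h6)
  exact (hinc N (N + 1) N.lt_succ_self).2.2 ((heq N le_rfl).trans (heq (N + 1) (by omega)).symm)

end Algebra

end ArensProducts

theorem corollary6 (𝕜 : Type*) [RCLike 𝕜] (A : Type*) [NonUnitalNormedRing A] [NormedSpace 𝕜 A]
    [IsScalarTower 𝕜 A A] [SMulCommClass 𝕜 A A] [CompleteSpace A]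
    (hreg : ArensProducts.IsArensRegular 𝕜 A)
    {ι : Type*} [Preorder ι] [IsDirectedOrder ι] [Nonempty ι] (e : ι → A)
    (he : ArensProducts.IsBAI e) :
    (ArensProducts.DualFactorsLeft 𝕜 A ∧ ArensProducts.DualFactorsRight 𝕜 A) ∧
      ArensProducts.HasUnit
        (ArensProducts.firstArens 𝕜 :
          StrongDual 𝕜 (StrongDual 𝕜 A) → StrongDual 𝕜 (StrongDual 𝕜 A) →
            StrongDual 𝕜 (StrongDual 𝕜 A)) ∧
      (ArensProducts.IsWeaklySeqComplete 𝕜 A →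
        ArensProducts.HasUnit (fun a b : A => a * b)) := by
  exact ⟨⟨ArensProducts.dualFactorsLeft_of_isArensRegular hreg he,
      ArensProducts.dualFactorsRight_of_isArensRegular hreg he⟩,
    ArensProducts.exists_firstArens_unit hreg he,
    fun hwsc => ArensProducts.hasUnit_of_isWeaklySeqComplete hreg hwsc he⟩
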